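/- For a set $S\subseteq\mathbb R^d$, the Carathéodory number $\mathfrak c(S)$ is the smallest positive integer $n$ such that every element of the convex hull of $S$ is a convex combination of at most $n$ elements of $S$. For bounded self-adjoint operators $T_1,\dots,T_d$ on a complex Hilbert space $H$, their joint numerical range is $$\mathcal W(T_1,\dots,T_d)=\{(\langle T_1h,h\rangle,\dots,\langle T_dh,h\rangle) : h\in H,\ \|h\|=1\}\subseteq\mathbb R^d.$$ **Theorem.** Let $d\ge 2$ and let $T_1,\dots,T_d$ be bounded self-adjoint operators on a complex Hilbert space $H$. Then $\mathfrak c(\mathcal W(T_1,\dots,T_d))\le d-1$. If moreover $d\ge 3$ and $\dim H\ge 3$, then $\mathfrak c(\mathcal W(T_1,\dots,T_d))\le d-2$. -/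

import Mathlib

/-- `x` is a convex combination of at most `n` elements of the set `S`. -/
def IsConvexCombOfAtMost {E : Type*} [AddCommGroup E] [Module ℝ E]
    (S : Set E) (n : ℕ) (x : E) : Prop :=
  ∃ t : Finset E, (t : Set E) ⊆ S ∧ t.card ≤ n ∧
    ∃ w : E → ℝ, (∀ y ∈ t, 0 ≤ w y) ∧ ∑ y ∈ t, w y = 1 ∧ ∑ y ∈ t, w y • y = x

/-- The Carathéodory number of `S`: the smallest positive integer `n` such that every element of
the convex hull of `S` is a convex combination of at most `n` elements of `S`
(and `⊤` if there is no such integer). -/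
noncomputable def caratheodoryNumber {E : Type*} [AddCommGroup E] [Module ℝ E]
    (S : Set E) : ℕ∞ :=
  sInf {m : ℕ∞ | ∃ n : ℕ, 0 < n ∧ (∀ x ∈ convexHull ℝ S, IsConvexCombOfAtMost S n x) ∧
    m = (n : ℕ∞)}

/-- The joint numerical range `{(⟨T₁ h, h⟩, …, ⟨T_d h, h⟩) | ‖h‖ = 1}`, as a subset of `ℝ^d`. The
entries `⟨T_i h, h⟩` are real when the operators are self-adjoint. -/
def jointNumericalRange {H : Type*} [NormedAddCommGroup H] [InnerProductSpace ℂ H]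
    {d : ℕ} (T : Fin d → H →L[ℂ] H) : Set (Fin d → ℝ) :=
  {x | ∃ h : H, ‖h‖ = 1 ∧ ∀ i, ((x i : ℝ) : ℂ) = inner ℂ (T i h) h}

/-!
A point `x` of the convex hull of the joint numerical range is the same thing as a finite family
`h₁, …, h_r` with `∑ ‖h_j‖² = 1` and `∑ ⟪T_i h_j, h_j⟫ = x_i` (`IsFormSum`), that is, a density
operator `∑ h_j h_j*` of rank at most `r` with prescribed expectations. Such a family exhibits `x`
as a convex combination of at most `r` points of the range, so the aim is to make `r` small.

*Lowering the rank by counting dimensions* (`exists_fewer_vectors`). The `r × r` Hermitian matrices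
`C` form a real space of dimension `r²`. If `r² > d + 1`, some `C ≠ 0` is annihilated by the
`d + 1` functionals `C ↦ ∑ C_{jk} ⟪S h_k, h_j⟫`, where `S` is the identity or some `T_i`. If `λ` is
an eigenvalue of `C` of largest modulus, `1 - C / λ` is positive semidefinite and singular, so it
turns the family into one of `r - 1` vectors with the same sums. This brings `r` down to `d - 1`
if `d ≥ 2`, and to `d - 2` if `d ≥ 4`.

*The case `d = 3`, `dim H ≥ 3`* (`exists_common_zero_of_sum_eq_zero`). Here the count stops at
`r = 2`, and the range has to be shown convex. Replacing `T_i` by `T_i - x_i`, one has `h₁, h₂`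
with `⟪S_i h₁, h₁⟫ + ⟪S_i h₂, h₂⟫ = 0` for three self-adjoint operators and looks for a common
zero `g ≠ 0` of the forms. On the span of `h₁`, `h₂` and a third independent vector, the
determinant of the form of `cos θ S₀ + sin θ S₁` changes sign between `θ = 0` and `θ = π`, so for
some `θ` this form, say `A`, has a kernel vector `k`. A unitary change of `h₁, h₂` into `e, f` makes
`A` diagonal with entries `m, -m`. For `m ≠ 0` the form `A` vanishes at `a e + b f + k` whenever
`|a| = |b|`; the two remaining forms, taken together as one complex-valued form, then give an
equation for `a, b` with leading term real linear in `a b̄`, which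
`exists_norm_eq_norm_of_surjective` solves: the phase of `a b̄` is fixed so that the leading term
is opposed to the constant one, and the common phase and modulus of `a, b` absorb the linear terms.
-/

open scoped ComplexConjugate InnerProductSpace Matrix

/-! ### Real linear equations over the complex numbers -/

/-- Every real linear endomorphism of `ℂ` has the form `z ↦ p z + q z̄`; it is injective if and only
if it is surjective. -/
lemma exists_norm_eq_one_or_surjective (p q : ℂ) :
    (∃ z : ℂ, ‖z‖ = 1 ∧ p * z + q * conj z = 0) ∨ ∀ c : ℂ, ∃ z : ℂ, p * z + q * conj z = c := by
  let f : ℂ →ₗ[ℝ] ℂ :=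
    { toFun := fun z => p * z + q * conj z
      map_add' := fun x y => by simp only [map_add]; ring
      map_smul' := fun r x => by
        simp only [Complex.real_smul, map_mul, Complex.conj_ofReal, RingHom.id_apply]; ring }
  by_cases hf : Function.Injective f
  · exact Or.inr fun c => LinearMap.injective_iff_surjective.mp hf c
  · left
    obtain ⟨z, hz, hz0⟩ : ∃ z, f z = 0 ∧ z ≠ 0 := by
      simpa [injective_iff_map_eq_zero] using hf
    refine ⟨(‖z‖⁻¹ : ℝ) • z, by simp [hz0], ?_⟩
    change f ((‖z‖⁻¹ : ℝ) • z) = 0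
    rw [map_smul, hz, smul_zero]

lemma exists_mul_sq_add_eq {u v : ℝ} (hu : 0 ≤ u) (hv : 0 ≤ v) :
    ∃ s : ℝ, u * s ^ 2 + s = v := by
  have hc : ContinuousOn (fun s : ℝ => u * s ^ 2 + s) (Set.Icc 0 v) := by fun_prop
  obtain ⟨s, -, h⟩ := intermediate_value_Icc hv hc
    (show v ∈ Set.Icc _ _ from ⟨by simpa using hv, by nlinarith [mul_nonneg hu (sq_nonneg v)]⟩)
  exact ⟨s, h⟩

/-- The equation `R(a b̄) + L₁ a + L₂ b + c = 0`, with `R`, `L₁`, `L₂` real linear and `R` onto, has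
a solution with `|a| = |b|`. -/
lemma exists_norm_eq_norm_of_surjective {p q : ℂ}
    (hpq : ∀ c : ℂ, ∃ z : ℂ, p * z + q * conj z = c) (p₁ q₁ p₂ q₂ c : ℂ) :
    ∃ a b : ℂ, ‖a‖ = ‖b‖ ∧ p * (a * conj b) + q * conj (a * conj b)
      + (p₁ * a + q₁ * conj a) + (p₂ * b + q₂ * conj b) + c = 0 := by
  obtain ⟨w, hw⟩ := hpq (-c)
  obtain ⟨s, hs, hws⟩ : ∃ s : ℂ, ‖s‖ = 1 ∧ w = ‖w‖ * s ^ 2 := by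
    refine ⟨Complex.exp ((w.arg / 2 : ℝ) * Complex.I), Complex.norm_exp_ofReal_mul_I _, ?_⟩
    rw [← Complex.exp_nat_mul]
    conv_lhs => rw [← Complex.norm_mul_exp_arg_mul_I w]
    congr 2; push_cast; ring
  have hwc : conj w = ‖w‖ * conj s ^ 2 := by
    conv_lhs => rw [hws]
    simp
  -- With `a = ρ s t` and `b = ρ s̄ t`, `ρ` real, `a b̄ = ρ² |t|² s²` is a real multiple of `w`,
  -- and the linear terms become `ρ L t` with `L t` the real linear map below.
  rcases exists_norm_eq_one_or_surjective (p₁ * s + p₂ * conj s) (q₁ * conj s + q₂ * s)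
    with ⟨t, ht, h⟩ | h
  -- `L t = 0` with `|t| = 1`: take `ρ² = |w|`, which cancels the constant term.
  · have htt : t * conj t = 1 := by
      rw [Complex.mul_conj, Complex.normSq_eq_norm_sq, ht]; simp
    have hr : ((√‖w‖ : ℝ) : ℂ) ^ 2 = (‖w‖ : ℂ) := by
      rw [← Complex.ofReal_pow, Real.sq_sqrt (norm_nonneg w)]
    refine ⟨(√‖w‖ : ℝ) * (s * t), (√‖w‖ : ℝ) * (conj s * t), by simp, ?_⟩
    simp only [map_mul, Complex.conj_ofReal, Complex.conj_conj]
    rw [hwc] at hw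
    rw [hws] at hw
    simp only [norm_mul, norm_pow, hs, Complex.norm_real, norm_norm, one_pow, mul_one] at hw
    linear_combination hw + (√‖w‖ : ℝ) * h
      + (p * s ^ 2 + q * conj s ^ 2) * (t * conj t * hr + ‖w‖ * htt)
  -- `L t = R(s²)`: every term is a multiple of `R(s²)`, and `ρ² |t|² + ρ = |w|` is left.
  · obtain ⟨t, ht⟩ := h (p * s ^ 2 + q * conj s ^ 2)
    obtain ⟨r, hrt⟩ := exists_mul_sq_add_eq (sq_nonneg ‖t‖) (norm_nonneg w)
    have hrt' : t * conj t * (r : ℂ) ^ 2 + r = ‖w‖ := by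
      rw [Complex.mul_conj, Complex.normSq_eq_norm_sq]; exact_mod_cast hrt
    refine ⟨r * (s * t), r * (conj s * t), by simp, ?_⟩
    simp only [map_mul, Complex.conj_ofReal, Complex.conj_conj]
    rw [hwc] at hw
    rw [hws] at hw
    simp only [norm_mul, norm_pow, hs, Complex.norm_real, norm_norm, one_pow, mul_one] at hw
    linear_combination hw + r * ht + (p * s ^ 2 + q * conj s ^ 2) * hrt'

/-! ### Common zeros of forms whose sums over a pair of vectors vanish -/

section

variable {H : Type*} [NormedAddCommGroup H] [InnerProductSpace ℂ H]

/-- If `f = c e`, the hypothesis reads `(1 + |c|²) ⟪S i e, e⟫ = 0`. -/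
lemma exists_common_zero_of_dependent {ι : Type*} (S : ι → H →L[ℂ] H) {e f : H}
    (hef : ∀ i, ⟪S i e, e⟫_ℂ + ⟪S i f, f⟫_ℂ = 0) (h0 : e ≠ 0 ∨ f ≠ 0)
    (hdep : ¬ LinearIndependent ℂ ![e, f]) :
    ∃ h : H, h ≠ 0 ∧ ∀ i, ⟪S i h, h⟫_ℂ = 0 := by
  have key : ∀ u v : H, (∀ i, ⟪S i u, u⟫_ℂ + ⟪S i v, v⟫_ℂ = 0) → u ≠ 0 → (∃ c : ℂ, c • u = v) →
      ∃ h : H, h ≠ 0 ∧ ∀ i, ⟪S i h, h⟫_ℂ = 0 := by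
    rintro u v huv hu ⟨c, rfl⟩
    refine ⟨u, hu, fun i => ?_⟩
    have h := huv i
    simp only [map_smul, inner_smul_left, inner_smul_right] at h
    have h1 : (1 + c * conj c) * ⟪S i u, u⟫_ℂ = 0 := by linear_combination h
    refine (mul_eq_zero.mp h1).resolve_left fun h2 => ?_
    rw [Complex.mul_conj] at h2
    have h3 : (1 : ℝ) + Complex.normSq c = 0 := by exact_mod_cast h2
    linarith [Complex.normSq_nonneg c]
  by_cases he : e = 0
  · subst he
    exact key f 0 (fun i => by simpa using hef i) (h0.resolve_left (by simp)) ⟨0, by simp⟩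
  · refine key e f hef he ?_
    rw [LinearIndependent.pair_iff' he] at hdep
    push Not at hdep
    exact hdep

/-- Here `A` is diagonal with entries `m, -m, 0` on the span of `e, f, k`. The operator `M` is
arbitrary, so `⟪M h, h⟫ = 0` amounts to two real equations. -/
lemma exists_common_zero_of_diagonal (A M : H →L[ℂ] H) {e f k : H} {m : ℂ}
    (hee : ⟪A e, e⟫_ℂ = m) (hff : ⟪A f, f⟫_ℂ = -m) (hAef : ⟪A e, f⟫_ℂ = 0) (hAfe : ⟪A f, e⟫_ℂ = 0)
    (hM : ⟪M e, e⟫_ℂ + ⟪M f, f⟫_ℂ = 0) (h0 : e ≠ 0 ∨ f ≠ 0) (hk : k ≠ 0)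
    (hke : ⟪A k, e⟫_ℂ = 0) (hkf : ⟪A k, f⟫_ℂ = 0) (hek : ⟪A e, k⟫_ℂ = 0) (hfk : ⟪A f, k⟫_ℂ = 0)
    (hkk : ⟪A k, k⟫_ℂ = 0) :
    ∃ h : H, h ≠ 0 ∧ ⟪A h, h⟫_ℂ = 0 ∧ ⟪M h, h⟫_ℂ = 0 := by
  by_cases hind : LinearIndependent ℂ ![e, f]
  swap
  · obtain ⟨h, hh, hz⟩ := exists_common_zero_of_dependent ![A, M] (e := e) (f := f)
      (by intro i; fin_cases i <;> simp [hee, hff, hM]) h0 hind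
    exact ⟨h, hh, hz 0, hz 1⟩
  rw [LinearIndependent.pair_iff] at hind
  have hM' : ⟪M f, f⟫_ℂ = -⟪M e, e⟫_ℂ := by linear_combination hM
  -- The off-diagonal part of `M` on `e, f` is `R(a b̄)` with `R z = ⟪M f, e⟫ z + ⟪M e, f⟫ z̄`. A zero
  -- `z` of `R` on the unit circle gives the common zero `z e + f`.
  rcases exists_norm_eq_one_or_surjective ⟪M f, e⟫_ℂ ⟪M e, f⟫_ℂ with ⟨z, hz, hz0⟩ | hsurj
  · have hzz : z * conj z = 1 := by
      rw [Complex.mul_conj, Complex.normSq_eq_norm_sq, hz]; simp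
    refine ⟨z • e + (1 : ℂ) • f, fun h => one_ne_zero (hind _ _ h).2, ?_, ?_⟩
    · simp only [map_add, map_smul, inner_add_left, inner_add_right, inner_smul_left,
        inner_smul_right, hee, hff, hAef, hAfe, map_one]
      linear_combination m * hzz
    · simp only [map_add, map_smul, inner_add_left, inner_add_right, inner_smul_left,
        inner_smul_right, hM', map_one]
      linear_combination ⟪M e, e⟫_ℂ * hzz + hz0
  by_cases hm : m = 0
  -- `A` vanishes on the span of `e, f`, so a zero of `M` of the form `a e + f` suffices.
  · subst hm
    obtain ⟨w, hw⟩ := hsurj ⟪M e, e⟫_ℂ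
    obtain ⟨s, hsw⟩ := exists_mul_sq_add_eq (sq_nonneg ‖w‖) zero_le_one
    have hsw' : w * conj w * (s : ℂ) ^ 2 + s = 1 := by
      rw [Complex.mul_conj, Complex.normSq_eq_norm_sq]; exact_mod_cast hsw
    refine ⟨(s * w) • e + (1 : ℂ) • f, fun h => one_ne_zero (hind _ _ h).2, ?_, ?_⟩
    · simp only [map_add, map_smul, inner_add_left, inner_add_right, inner_smul_left,
        inner_smul_right, hee, hff, hAef, hAfe]
      ring
    · simp only [map_add, map_smul, inner_add_left, inner_add_right, inner_smul_left,
        inner_smul_right, hM', map_one, map_mul, Complex.conj_ofReal]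
      linear_combination s * hw + ⟪M e, e⟫_ℂ * hsw'
  -- For `|a| = |b|` the diagonal parts of `A` and `M` on `e, f` cancel.
  · obtain ⟨a, b, hab, h⟩ := exists_norm_eq_norm_of_surjective hsurj
      ⟪M k, e⟫_ℂ ⟪M e, k⟫_ℂ ⟪M k, f⟫_ℂ ⟪M f, k⟫_ℂ ⟪M k, k⟫_ℂ
    have hab' : a * conj a = b * conj b := by
      rw [Complex.mul_conj, Complex.mul_conj, Complex.normSq_eq_norm_sq,
        Complex.normSq_eq_norm_sq, hab]
    refine ⟨a • e + b • f + k, fun h => hk ?_, ?_, ?_⟩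
    · have h1 : ⟪A (a • e + b • f + k), e⟫_ℂ = 0 := by rw [h]; simp
      have h2 : ⟪A (a • e + b • f + k), f⟫_ℂ = 0 := by rw [h]; simp
      simp only [map_add, map_smul, inner_add_left, inner_smul_left, hee, hff, hAef, hAfe, hke,
        hkf, mul_zero, add_zero, zero_add, mul_neg, neg_eq_zero, mul_eq_zero, hm, or_false,
        map_eq_zero] at h1 h2
      simpa [h1, h2] using h
    · simp only [map_add, map_smul, inner_add_left, inner_add_right, inner_smul_left,
        inner_smul_right, hee, hff, hAef, hAfe, hke, hkf, hek, hfk, hkk]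
      linear_combination m * hab'
    · simp only [map_add, map_smul, inner_add_left, inner_add_right, inner_smul_left,
        inner_smul_right, hM']
      simp only [map_mul, Complex.conj_conj] at h
      linear_combination h + ⟪M e, e⟫_ℂ * hab'

/-! ### The matrix of a form on a family of vectors -/

/-- The matrix of the form of `S` on the family `h`. Entry `(j, k)` is `⟪S h_j, h_k⟫`, so the row
index is the conjugate linear one. -/
noncomputable def formMatrix {n : Type*} (S : H →L[ℂ] H) (h : n → H) : Matrix n n ℂ :=
  Matrix.of fun j k => ⟪S (h j), h k⟫_ℂ

lemma formMatrix_sum_smul {n : Type*} [Fintype n] (S : H →L[ℂ] H) (h : n → H)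
    (V : Matrix n n ℂ) :
    formMatrix S (fun l => ∑ j, V j l • h j) = Vᴴ * formMatrix S h * V := by
  ext l m
  simp only [formMatrix, Matrix.of_apply, Matrix.mul_apply, Matrix.conjTranspose_apply, map_sum,
    map_smul, sum_inner, inner_sum, inner_smul_left, inner_smul_right, Finset.sum_mul]
  refine Finset.sum_congr rfl fun j _ => ?_
  rw [Finset.mul_sum]
  refine Finset.sum_congr rfl fun k _ => ?_
  rw [starRingEnd_apply]
  ring

lemma formMatrix_isHermitian {n : Type*} [CompleteSpace H] {S : H →L[ℂ] H} (hS : IsSelfAdjoint S)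
    (h : n → H) : (formMatrix S h).IsHermitian := by
  ext j k
  simp only [formMatrix, Matrix.conjTranspose_apply, Matrix.of_apply]
  rw [← starRingEnd_apply, inner_conj_symm]
  exact (hS.isSymmetric (h j) (h k)).symm

/-! ### Lowering the number of vectors -/

/-- The Hermitian matrix `(X + Xᵀ) + i (X - Xᵀ)`. This real linear injection shows that Hermitian
matrices form a real space of dimension at least `n²`. -/
def hermitianOfReal (n : Type*) : Matrix n n ℝ →ₗ[ℝ] Matrix n n ℂ where
  toFun X := Matrix.of fun j k => ⟨X j k + X k j, X j k - X k j⟩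
  map_add' X Y := by ext j k; apply Complex.ext <;> simp <;> ring
  map_smul' r X := by ext j k; apply Complex.ext <;> simp <;> ring

lemma hermitianOfReal_isHermitian {n : Type*} (X : Matrix n n ℝ) :
    (hermitianOfReal n X).IsHermitian := by
  ext j k
  apply Complex.ext <;> simp [hermitianOfReal, add_comm]

lemma hermitianOfReal_eq_zero {n : Type*} {X : Matrix n n ℝ} (h : hermitianOfReal n X = 0) :
    X = 0 := by
  ext j k
  have h1 := congrFun (congrFun h j) k
  have h2 := congrArg Complex.re h1
  have h3 := congrArg Complex.im h1
  simp [hermitianOfReal] at h2 h3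
  simp; linarith

/-- The space of Hermitian matrices has real dimension `n²`, more than the number of conditions. -/
lemma exists_hermitian_trace_eq_zero {ι n : Type*} [Fintype ι] [Fintype n]
    (G : ι → Matrix n n ℂ) (hc : Fintype.card ι < Fintype.card n ^ 2) :
    ∃ C : Matrix n n ℂ, C.IsHermitian ∧ C ≠ 0 ∧ ∀ i, (Matrix.trace (C * G i)).re = 0 := by
  let φ : Matrix n n ℝ →ₗ[ℝ] (ι → ℝ) := LinearMap.pi fun i =>
    Complex.reLm ∘ₗ Matrix.traceLinearMap n ℝ ℂ ∘ₗ LinearMap.mulRight ℝ (G i) ∘ₗ hermitianOfReal n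
  have hker : LinearMap.ker φ ≠ ⊥ := LinearMap.ker_ne_bot_of_finrank_lt (by
    simpa [Module.finrank_matrix, sq] using hc)
  obtain ⟨X, hX, hX0⟩ := (Submodule.ne_bot_iff _).mp hker
  exact ⟨hermitianOfReal n X, hermitianOfReal_isHermitian X,
    fun h => hX0 (hermitianOfReal_eq_zero h), fun i => congrFun hX i⟩

/-- Fewer than `(r + 1)²` forms cannot tell a suitable family of `r` vectors from a given family of
`r + 1` vectors by their sums. -/
theorem exists_fewer_vectors {ι : Type*} [Fintype ι] (S : ι → H →L[ℂ] H) {r : ℕ}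
    (hr : Fintype.card ι < (r + 1) ^ 2) (h : Fin (r + 1) → H) :
    ∃ g : Fin r → H, ∀ i, ∑ j, (⟪S i (g j), g j⟫_ℂ).re = ∑ j, (⟪S i (h j), h j⟫_ℂ).re := by
  obtain ⟨C, hC, hC0, hCG⟩ := exists_hermitian_trace_eq_zero (fun i => formMatrix (S i) h)
    (by simpa using hr)
  set V : Matrix (Fin (r + 1)) (Fin (r + 1)) ℂ := hC.eigenvectorUnitary.1
  set μ := hC.eigenvalues
  have hVV : V * Vᴴ = 1 := Unitary.coe_mul_star_self hC.eigenvectorUnitary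
  have hspec : C = V * Matrix.diagonal (fun l => (μ l : ℂ)) * Vᴴ := by
    have := hC.spectral_theorem
    rw [Unitary.conjStarAlgAut_apply] at this
    exact this
  let e : Fin (r + 1) → H := fun l => ∑ j, V j l • h j
  have he : ∀ i, Vᴴ * formMatrix (S i) h * V = formMatrix (S i) e := fun i =>
    (formMatrix_sum_smul (S i) h V).symm
  have hsum : ∀ i, ∑ l, (⟪S i (e l), e l⟫_ℂ).re = ∑ j, (⟪S i (h j), h j⟫_ℂ).re := by
    intro i
    have : Matrix.trace (formMatrix (S i) e) = Matrix.trace (formMatrix (S i) h) := by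
      rw [← he, Matrix.trace_mul_comm, ← mul_assoc, hVV, one_mul]
    simpa [Matrix.trace, formMatrix] using congrArg Complex.re this
  have hzero : ∀ i, ∑ l, μ l * (⟪S i (e l), e l⟫_ℂ).re = 0 := by
    intro i
    have : Matrix.trace (C * formMatrix (S i) h)
        = Matrix.trace (Matrix.diagonal (fun l => (μ l : ℂ)) * formMatrix (S i) e) := by
      rw [← he]
      conv_lhs => rw [hspec]
      rw [mul_assoc, mul_assoc, Matrix.trace_mul_comm V]
      simp only [mul_assoc]
    have h2 := hCG i
    rw [this] at h2
    simpa [Matrix.trace, formMatrix, Matrix.diagonal_mul] using h2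
  -- Weighting `e l` by `1 - μ l / μ l₀` preserves the sums. The weights are nonnegative because
  -- `|μ l₀|` is maximal, whatever the sign of `μ l₀`, and the weight of `e l₀` is zero.
  obtain ⟨l₀, -, hl₀⟩ := Finset.exists_max_image Finset.univ (fun l => |μ l|)
    Finset.univ_nonempty
  have hμ0 : μ l₀ ≠ 0 := by
    intro h0
    refine hC0 (hC.eigenvalues_eq_zero_iff.mp (funext fun l => ?_))
    have := hl₀ l (Finset.mem_univ _)
    rw [h0, abs_zero] at this
    exact abs_nonpos_iff.mp this
  have hnn : ∀ l, 0 ≤ 1 - μ l / μ l₀ := by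
    intro l
    have h1 : |μ l / μ l₀| ≤ 1 := by
      rw [abs_div]
      exact div_le_one_of_le₀ (hl₀ l (Finset.mem_univ _)) (abs_nonneg _)
    linarith [le_abs_self (μ l / μ l₀)]
  refine ⟨fun j => ((√(1 - μ (l₀.succAbove j) / μ l₀) : ℝ) : ℂ) • e (l₀.succAbove j), fun i => ?_⟩
  have hterm : ∀ l, (⟪S i (((√(1 - μ l / μ l₀) : ℝ) : ℂ) • e l),
      ((√(1 - μ l / μ l₀) : ℝ) : ℂ) • e l⟫_ℂ).re
      = (1 - μ l / μ l₀) * (⟪S i (e l), e l⟫_ℂ).re := by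
    intro l
    rw [map_smul, inner_smul_left, inner_smul_right, Complex.conj_ofReal, Complex.re_ofReal_mul,
      Complex.re_ofReal_mul, ← mul_assoc, Real.mul_self_sqrt (hnn l)]
  have htot : ∑ l, (1 - μ l / μ l₀) * (⟪S i (e l), e l⟫_ℂ).re = ∑ j, (⟪S i (h j), h j⟫_ℂ).re := by
    have : ∑ l, (1 - μ l / μ l₀) * (⟪S i (e l), e l⟫_ℂ).re
        = ∑ l, (⟪S i (e l), e l⟫_ℂ).re - (μ l₀)⁻¹ * ∑ l, μ l * (⟪S i (e l), e l⟫_ℂ).re := by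
      rw [Finset.mul_sum, ← Finset.sum_sub_distrib]
      exact Finset.sum_congr rfl fun l _ => by ring
    rw [this, hzero, mul_zero, sub_zero, hsum]
  rw [Fin.sum_univ_succAbove _ l₀, div_self hμ0, sub_self, zero_mul, zero_add] at htot
  rw [← htot]
  exact Finset.sum_congr rfl fun j _ => hterm _

/-! ### Three forms on a space of dimension at least three -/

/-- A unitary change of the pair `h` diagonalizes the form of `A` and preserves the sum of every form
over the pair. -/
lemma exists_diagonalizing_pair [CompleteSpace H] {A : H →L[ℂ] H} (hA : IsSelfAdjoint A)
    (h : Fin 2 → H) : ∃ e : Fin 2 → H,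
      (∀ S : H →L[ℂ] H, ⟪S (e 0), e 0⟫_ℂ + ⟪S (e 1), e 1⟫_ℂ = ⟪S (h 0), h 0⟫_ℂ + ⟪S (h 1), h 1⟫_ℂ) ∧
      ⟪A (e 0), e 1⟫_ℂ = 0 ∧ ∀ l, e l ∈ Submodule.span ℂ (Set.range h) := by
  have hC := formMatrix_isHermitian hA h
  set V : Matrix (Fin 2) (Fin 2) ℂ := hC.eigenvectorUnitary.1
  have hVV : V * Vᴴ = 1 := Unitary.coe_mul_star_self hC.eigenvectorUnitary
  refine ⟨fun l => ∑ j, V j l • h j, fun S => ?_, ?_, fun l => ?_⟩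
  · have : Matrix.trace (formMatrix S (fun l => ∑ j, V j l • h j))
        = Matrix.trace (formMatrix S h) := by
      rw [formMatrix_sum_smul, Matrix.trace_mul_comm, ← mul_assoc, hVV, one_mul]
    simpa only [Matrix.trace, Fin.sum_univ_two, Matrix.diag_apply, formMatrix, Matrix.of_apply]
      using this
  · have h1 := hC.conjStarAlgAut_star_eigenvectorUnitary
    rw [Unitary.conjStarAlgAut_star_apply] at h1
    have h2 : formMatrix A (fun l => ∑ j, V j l • h j) 0 1 = 0 := by
      rw [formMatrix_sum_smul]
      exact (congrFun (congrFun h1 0) 1).trans (by simp)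
    exact h2
  · exact Submodule.sum_mem _ fun j _ => Submodule.smul_mem _ _
      (Submodule.subset_span (Set.mem_range_self j))

/-- The determinant of the form of `cos θ A + sin θ B` on a three-dimensional space is real and
changes sign when `θ` is increased by `π`, the dimension being odd. -/
lemma exists_rotation_kernel [CompleteSpace H] {A B : H →L[ℂ] H} (hA : IsSelfAdjoint A)
    (hB : IsSelfAdjoint B) {v : Fin 3 → H} (hv : LinearIndependent ℂ v) :
    ∃ (θ : ℝ) (k : H), k ≠ 0 ∧ k ∈ Submodule.span ℂ (Set.range v) ∧
      ∀ x ∈ Submodule.span ℂ (Set.range v),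
        ⟪((Real.cos θ : ℂ) • A + (Real.sin θ : ℂ) • B) k, x⟫_ℂ = 0 := by
  let M : ℝ → Matrix (Fin 3) (Fin 3) ℂ := fun θ =>
    (Real.cos θ : ℂ) • formMatrix A v + (Real.sin θ : ℂ) • formMatrix B v
  have hherm : ∀ θ, (M θ).IsHermitian := by
    intro θ
    ext j k
    have h1 := congrFun (congrFun (formMatrix_isHermitian hA v) j) k
    have h2 := congrFun (congrFun (formMatrix_isHermitian hB v) j) k
    simp only [Matrix.conjTranspose_apply] at h1 h2
    simp only [M, Matrix.conjTranspose_apply, Matrix.add_apply, Matrix.smul_apply, smul_eq_mul,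
      star_add, star_mul', h1, h2]
    simp only [← starRingEnd_apply, Complex.conj_ofReal]
  have hreal : ∀ θ, ((M θ).det.re : ℂ) = (M θ).det := by
    intro θ
    rw [← Complex.conj_eq_iff_re, starRingEnd_apply, ← Matrix.det_conjTranspose, hherm θ]
  have hcont : Continuous fun θ => (M θ).det.re := by
    refine Complex.continuous_re.comp (Continuous.matrix_det ?_)
    fun_prop
  have hpi : (M Real.pi).det.re = -(M 0).det.re := by
    have : M Real.pi = -M 0 := by simp [M]
    rw [this, Matrix.det_neg]
    simp [pow_succ]
  obtain ⟨θ, hθ⟩ : ∃ θ, (M θ).det.re = 0 := by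
    have hmem : (0 : ℝ) ∈ Set.uIcc ((M 0).det.re) ((M Real.pi).det.re) := by
      rw [hpi, Set.mem_uIcc]
      rcases le_total 0 (M 0).det.re with h | h
      · right; constructor <;> linarith
      · left; constructor <;> linarith
    obtain ⟨θ, -, h⟩ := intermediate_value_uIcc (hcont.continuousOn) hmem
    exact ⟨θ, h⟩
  have hdet : (M θ).det = 0 := by rw [← hreal, hθ, Complex.ofReal_zero]
  obtain ⟨c, hc, hcM⟩ := Matrix.exists_vecMul_eq_zero_iff.mpr hdet
  refine ⟨θ, ∑ j, conj (c j) • v j, fun h0 => hc ?_, Submodule.sum_mem _ fun j _ =>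
    Submodule.smul_mem _ _ (Submodule.subset_span (Set.mem_range_self j)), fun x hx => ?_⟩
  · have := Fintype.linearIndependent_iff.mp hv _ h0
    funext j
    simpa using this j
  · induction hx using Submodule.span_induction with
    | mem x hx =>
      obtain ⟨l, rfl⟩ := hx
      have h1 := congrFun hcM l
      simp only [Matrix.vecMul, dotProduct, M, Matrix.add_apply, Matrix.smul_apply, smul_eq_mul,
        formMatrix, Matrix.of_apply, Pi.zero_apply] at h1
      simp only [map_sum, map_smul, sum_inner, inner_smul_left, add_apply,
        smul_apply, inner_add_left, Complex.conj_conj, Complex.conj_ofReal]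
      exact h1
    | zero => simp
    | add x y _ _ hx hy => rw [inner_add_right, hx, hy, add_zero]
    | smul a x _ hx => rw [inner_smul_right, hx, mul_zero]

/-- If three self-adjoint operators on a space of dimension at least three have forms with
vanishing sums over a nonzero pair of vectors, the forms have a common nonzero zero. In dimension
two this fails: the Pauli matrices are a counterexample. -/
theorem exists_common_zero_of_sum_eq_zero [CompleteSpace H] (hH : 3 ≤ Module.rank ℂ H)
    {S : Fin 3 → H →L[ℂ] H} (hS : ∀ i, IsSelfAdjoint (S i)) {h : Fin 2 → H} (h0 : h ≠ 0)
    (hsum : ∀ i, ⟪S i (h 0), h 0⟫_ℂ + ⟪S i (h 1), h 1⟫_ℂ = 0) :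
    ∃ g : H, g ≠ 0 ∧ ∀ i, ⟪S i g, g⟫_ℂ = 0 := by
  have h0' : h 0 ≠ 0 ∨ h 1 ≠ 0 := by
    by_contra! hcon
    exact h0 (funext fun j => by fin_cases j <;> simp [hcon])
  by_cases hind : LinearIndependent ℂ ![h 0, h 1]
  swap
  · exact exists_common_zero_of_dependent S hsum h0' hind
  have heta : ![h 0, h 1] = h := by ext j; fin_cases j <;> rfl
  rw [heta] at hind
  obtain ⟨x, hx⟩ := exists_linearIndependent_snoc_of_lt_rank hind
    (lt_of_lt_of_le (by norm_num) hH)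
  obtain ⟨θ, k, hk0, hk, hkv⟩ := exists_rotation_kernel (hS 0) (hS 1) hx
  have hsub : Submodule.span ℂ (Set.range h) ≤
      Submodule.span ℂ (Set.range (Fin.snoc h x : Fin 3 → H)) := by
    refine Submodule.span_mono ?_
    rintro _ ⟨j, rfl⟩
    exact ⟨j.castSucc, by rw [Fin.snoc_castSucc]⟩
  set A : H →L[ℂ] H := (Real.cos θ : ℂ) • S 0 + (Real.sin θ : ℂ) • S 1
  set B : H →L[ℂ] H := (Real.sin θ : ℂ) • S 0 - (Real.cos θ : ℂ) • S 1
  have hreal : ∀ r : ℝ, IsSelfAdjoint (r : ℂ) := fun r => Complex.conj_ofReal r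
  have hA : IsSelfAdjoint A := ((hreal _).smul (hS 0)).add ((hreal _).smul (hS 1))
  have hB : IsSelfAdjoint B := ((hreal _).smul (hS 0)).sub ((hreal _).smul (hS 1))
  obtain ⟨e, he, heA, hes⟩ := exists_diagonalizing_pair hA h
  have hzA : ⟪A (e 0), e 0⟫_ℂ + ⟪A (e 1), e 1⟫_ℂ = 0 := by
    rw [he]
    simp only [A, add_apply, smul_apply, inner_add_left,
      inner_smul_left]
    linear_combination conj (Real.cos θ : ℂ) * hsum 0 + conj (Real.sin θ : ℂ) * hsum 1
  have hzM : ⟪(B + Complex.I • S 2) (e 0), e 0⟫_ℂ + ⟪(B + Complex.I • S 2) (e 1), e 1⟫_ℂ = 0 := by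
    rw [he]
    simp only [B, add_apply, sub_apply,
      smul_apply, inner_add_left, inner_sub_left, inner_smul_left]
    linear_combination conj (Real.sin θ : ℂ) * hsum 0 - conj (Real.cos θ : ℂ) * hsum 1
      + conj Complex.I * hsum 2
  have hsymm : ∀ u v, ⟪A u, v⟫_ℂ = 0 → ⟪A v, u⟫_ℂ = 0 := by
    intro u v huv
    rw [show ⟪A v, u⟫_ℂ = ⟪v, A u⟫_ℂ from hA.isSymmetric v u, ← inner_conj_symm, huv, map_zero]
  have he0 : e 0 ≠ 0 ∨ e 1 ≠ 0 := by
    by_contra! hcon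
    have h1 := he (1 : H →L[ℂ] H)
    rw [hcon.1, hcon.2, map_zero, inner_zero_left, add_zero] at h1
    simp only [one_apply_eq_self, inner_self_eq_norm_sq_to_K] at h1
    have h2 : ‖h 0‖ ^ 2 + ‖h 1‖ ^ 2 = 0 :=
      Complex.ofReal_eq_zero.mp (by push_cast; exact h1.symm)
    rcases h0' with h' | h' <;> have := norm_pos_iff.mpr h' <;>
      nlinarith [sq_nonneg ‖h 0‖, sq_nonneg ‖h 1‖]
  have hke : ∀ l, ⟪A k, e l⟫_ℂ = 0 := fun l => hkv _ (hsub (hes l))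
  -- `⟪B g, g⟫` and `⟪S 2 g, g⟫` are real, so they are the real and, up to sign, imaginary part of
  -- the form of `B + i S 2`. A common zero of `A`, `B`, `S 2` is one of `S 0`, `S 1`, `S 2`, since
  -- `A`, `B` arise from `S 0`, `S 1` by a reflection.
  obtain ⟨g, hg0, hgA, hgM⟩ := exists_common_zero_of_diagonal A (B + Complex.I • S 2) rfl
    (eq_neg_of_add_eq_zero_right hzA) heA (hsymm _ _ heA) hzM he0 hk0 (hke 0) (hke 1)
    (hsymm _ _ (hke 0)) (hsymm _ _ (hke 1)) (hkv k hk)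
  refine ⟨g, hg0, ?_⟩
  have hre : ∀ {X : H →L[ℂ] H}, IsSelfAdjoint X → ((⟪X g, g⟫_ℂ).re : ℂ) = ⟪X g, g⟫_ℂ :=
    fun hX => hX.isSymmetric.coe_re_inner_apply_self g
  have hM' : ⟪B g, g⟫_ℂ - ⟪S 2 g, g⟫_ℂ * Complex.I = 0 := by
    simpa [inner_add_left, inner_smul_left, ← sub_eq_add_neg] using hgM
  rw [← hre hB, ← hre (hS 2)] at hM'
  have hB0 : ⟪B g, g⟫_ℂ = 0 := by
    rw [← hre hB]
    simpa using congrArg Complex.re hM'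
  have h20 : ⟪S 2 g, g⟫_ℂ = 0 := by
    rw [← hre (hS 2)]
    simpa using congrArg Complex.im hM'
  simp only [A, B, add_apply, sub_apply,
    smul_apply, inner_add_left, inner_sub_left, inner_smul_left,
    Complex.conj_ofReal] at hgA hB0
  have hcs : (Real.cos θ : ℂ) ^ 2 + (Real.sin θ : ℂ) ^ 2 = 1 := by
    exact_mod_cast Real.cos_sq_add_sin_sq θ
  intro i
  fin_cases i
  · change ⟪S 0 g, g⟫_ℂ = 0
    linear_combination (Real.cos θ : ℂ) * hgA + (Real.sin θ : ℂ) * hB0 - ⟪S 0 g, g⟫_ℂ * hcs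
  · change ⟪S 1 g, g⟫_ℂ = 0
    linear_combination (Real.sin θ : ℂ) * hgA - (Real.cos θ : ℂ) * hB0 - ⟪S 1 g, g⟫_ℂ * hcs
  · exact h20

/-! ### The convex hull of the joint numerical range -/

/-- The point `x` is given by the density operator `∑ h_j h_j*` with `r` summands, namely
`x_i = ∑ ⟪T_i h_j, h_j⟫`. The vectors `h_j` absorb the weights of a convex combination, and some of
them may be zero. -/
def IsFormSum {d : ℕ} (T : Fin d → H →L[ℂ] H) (r : ℕ) (x : Fin d → ℝ) : Prop :=
  ∃ h : Fin r → H, ∑ j, ‖h j‖ ^ 2 = 1 ∧ ∀ i, ∑ j, (⟪T i (h j), h j⟫_ℂ).re = x i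

lemma exists_isFormSum_of_mem_convexHull {d : ℕ} {T : Fin d → H →L[ℂ] H} {x : Fin d → ℝ}
    (hx : x ∈ convexHull ℝ (jointNumericalRange T)) : ∃ r, IsFormSum T r x := by
  obtain ⟨ι, _, w, z, hw, hw1, hz, hwz⟩ := mem_convexHull_iff_exists_fintype.mp hx
  choose h hh hT using hz
  refine ⟨Fintype.card ι, fun j => ((√(w ((Fintype.equivFin ι).symm j)) : ℝ) : ℂ) •
    h ((Fintype.equivFin ι).symm j), ?_, fun i => ?_⟩
  · rw [(Fintype.equivFin ι).symm.sum_comp (fun j => ‖((√(w j) : ℝ) : ℂ) • h j‖ ^ 2), ← hw1]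
    refine Finset.sum_congr rfl fun j _ => ?_
    rw [norm_smul, hh, mul_one, Complex.norm_real, Real.norm_eq_abs, sq_abs, Real.sq_sqrt (hw j)]
  · rw [(Fintype.equivFin ι).symm.sum_comp (fun j => (⟪T i (((√(w j) : ℝ) : ℂ) • h j),
      ((√(w j) : ℝ) : ℂ) • h j⟫_ℂ).re), ← hwz, Finset.sum_apply]
    refine Finset.sum_congr rfl fun j _ => ?_
    rw [map_smul, inner_smul_left, inner_smul_right, ← hT, Complex.conj_ofReal,
      Complex.re_ofReal_mul, Complex.re_ofReal_mul, ← mul_assoc, Real.mul_self_sqrt (hw j)]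
    rfl

lemma IsFormSum.pred {d : ℕ} {T : Fin d → H →L[ℂ] H} {r : ℕ} {x : Fin d → ℝ}
    (h : IsFormSum T (r + 1) x) (hr : d + 1 < (r + 1) ^ 2) : IsFormSum T r x := by
  obtain ⟨v, hv, hT⟩ := h
  obtain ⟨g, hg⟩ := exists_fewer_vectors (fun i : Option (Fin d) => i.elim 1 T)
    (by simpa using hr) v
  refine ⟨g, ?_, fun i => (hg (some i)).trans (hT i)⟩
  have hre : ∀ y : H, (⟪(1 : H →L[ℂ] H) y, y⟫_ℂ).re = ‖y‖ ^ 2 := fun y =>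
    inner_self_eq_norm_sq (𝕜 := ℂ) y
  have h1 := hg none
  simp only [Option.elim_none, hre] at h1
  rw [h1, hv]

lemma IsFormSum.exists_le {d n : ℕ} (hn : ∀ r, n ≤ r → d + 1 < (r + 1) ^ 2)
    {T : Fin d → H →L[ℂ] H} {r : ℕ} {x : Fin d → ℝ} (h : IsFormSum T r x) :
    ∃ m ≤ n, IsFormSum T m x := by
  induction r with
  | zero => exact ⟨0, n.zero_le, h⟩
  | succ r ih =>
    rcases Nat.lt_or_ge r n with hr | hr
    · exact ⟨r + 1, hr, h⟩
    · exact ih (h.pred (hn r hr))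

/-- Passage from indexed convex combinations to sets of points: the weights of coinciding points
are added. -/
lemma isConvexCombOfAtMost_of_sum {E ι : Type*} [AddCommGroup E] [Module ℝ E] {S : Set E}
    {x : E} (s : Finset ι) (w : ι → ℝ) (z : ι → E) (hw : ∀ j ∈ s, 0 ≤ w j)
    (hw1 : ∑ j ∈ s, w j = 1) (hz : ∀ j ∈ s, z j ∈ S) (hx : ∑ j ∈ s, w j • z j = x) :
    IsConvexCombOfAtMost S s.card x := by
  classical
  have hmap : ∀ j ∈ s, z j ∈ s.image z := fun j hj => Finset.mem_image_of_mem z hj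
  refine ⟨s.image z, by simpa [Set.subset_def] using hz, Finset.card_image_le,
    fun y => ∑ j ∈ s with z j = y, w j,
    fun y _ => Finset.sum_nonneg fun j hj => hw j (Finset.mem_filter.mp hj).1, ?_, ?_⟩
  · rw [Finset.sum_fiberwise_of_maps_to hmap, hw1]
  · rw [← hx, ← Finset.sum_fiberwise_of_maps_to hmap]
    refine Finset.sum_congr rfl fun y _ => ?_
    rw [Finset.sum_smul]
    exact Finset.sum_congr rfl fun j hj => by rw [(Finset.mem_filter.mp hj).2]

lemma IsFormSum.isConvexCombOfAtMost [CompleteSpace H] {d r n : ℕ} {T : Fin d → H →L[ℂ] H}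
    (hT : ∀ i, IsSelfAdjoint (T i)) {x : Fin d → ℝ} (h : IsFormSum T r x) (hrn : r ≤ n) :
    IsConvexCombOfAtMost (jointNumericalRange T) n x := by
  obtain ⟨v, hv, hx⟩ := h
  classical
  have hzero : ∀ j, ‖v j‖ ^ 2 ≠ 0 → v j ≠ 0 := fun j hj h0 => hj (by simp [h0])
  have hcard : (Finset.univ.filter fun j => v j ≠ 0).card ≤ n :=
    (Finset.card_filter_le _ _).trans (by simpa using hrn)
  suffices hs : IsConvexCombOfAtMost (jointNumericalRange T)
      (Finset.univ.filter fun j => v j ≠ 0).card x by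
    obtain ⟨t, ht, htc, hw⟩ := hs
    exact ⟨t, ht, htc.trans hcard, hw⟩
  refine isConvexCombOfAtMost_of_sum _ (fun j => ‖v j‖ ^ 2)
    (fun j i => (⟪T i (v j), v j⟫_ℂ).re / ‖v j‖ ^ 2) (fun j _ => sq_nonneg _)
    ((Finset.sum_filter_of_ne fun j _ hj => hzero j hj).trans hv) ?_ ?_
  · intro j hj
    have hj0 : v j ≠ 0 := (Finset.mem_filter.mp hj).2
    refine ⟨((‖v j‖⁻¹ : ℝ) : ℂ) • v j, by simp [norm_smul, hj0], fun i => ?_⟩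
    have hre : ((⟪T i (v j), v j⟫_ℂ).re : ℂ) = ⟪T i (v j), v j⟫_ℂ :=
      (hT i).isSymmetric.coe_re_inner_apply_self (v j)
    rw [map_smul, inner_smul_left, inner_smul_right, Complex.conj_ofReal, ← hre]
    push_cast
    ring
  · funext i
    rw [Finset.sum_apply, ← hx i, Finset.sum_filter]
    refine Finset.sum_congr rfl fun j _ => ?_
    by_cases hj : v j = 0
    · simp [hj]
    · have : ‖v j‖ ^ 2 ≠ 0 := pow_ne_zero _ (norm_ne_zero_iff.mpr hj)
      rw [if_pos hj, Pi.smul_apply, smul_eq_mul]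
      field_simp

/-- The joint numerical range of three operators on a space of dimension at least three is convex. -/
lemma IsFormSum.one_of_two [CompleteSpace H] (hH : 3 ≤ Module.rank ℂ H)
    {T : Fin 3 → H →L[ℂ] H} (hT : ∀ i, IsSelfAdjoint (T i)) {x : Fin 3 → ℝ}
    (h : IsFormSum T 2 x) : IsFormSum T 1 x := by
  obtain ⟨v, hv, hx⟩ := h
  have hre : ∀ i y, ((⟪T i y, y⟫_ℂ).re : ℂ) = ⟪T i y, y⟫_ℂ :=
    fun i y => (hT i).isSymmetric.coe_re_inner_apply_self y
  have hS : ∀ i y, ⟪(T i - (x i : ℂ) • (1 : H →L[ℂ] H)) y, y⟫_ℂ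
      = (((⟪T i y, y⟫_ℂ).re - x i * ‖y‖ ^ 2 : ℝ) : ℂ) := by
    intro i y
    rw [sub_apply, inner_sub_left, smul_apply, one_apply_eq_self, inner_smul_left,
      Complex.conj_ofReal, inner_self_eq_norm_sq_to_K, ← hre]
    push_cast
    rfl
  obtain ⟨g, hg, hgz⟩ := exists_common_zero_of_sum_eq_zero hH
    (S := fun i => T i - (x i : ℂ) • (1 : H →L[ℂ] H)) (h := v)
    (fun i => (hT i).sub (.smul (Complex.conj_ofReal (x i)) (.one _)))
    (by rintro rfl; simp at hv) (fun i => by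
      simp only [Fin.sum_univ_two] at hv hx
      simp only [hS, ← Complex.ofReal_add]
      rw [Complex.ofReal_eq_zero]
      linear_combination hx i - x i * hv)
  have hg' : ‖g‖ ≠ 0 := norm_ne_zero_iff.mpr hg
  refine ⟨fun _ => ((‖g‖⁻¹ : ℝ) : ℂ) • g, by simp [norm_smul, hg], fun i => ?_⟩
  have h1 : (⟪T i g, g⟫_ℂ).re = x i * ‖g‖ ^ 2 := by
    have := hgz i
    rw [hS, Complex.ofReal_eq_zero] at this
    linarith
  rw [Fin.sum_univ_one, map_smul, inner_smul_left, inner_smul_right, Complex.conj_ofReal,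
    Complex.re_ofReal_mul, Complex.re_ofReal_mul, h1]
  field_simp

lemma caratheodoryNumber_le {E : Type*} [AddCommGroup E] [Module ℝ E] {S : Set E} {n : ℕ}
    (hn : 0 < n) (h : ∀ x ∈ convexHull ℝ S, IsConvexCombOfAtMost S n x) :
    caratheodoryNumber S ≤ n :=
  sInf_le ⟨n, hn, h, rfl⟩

end

theorem theorem1 {H : Type*} [NormedAddCommGroup H] [InnerProductSpace ℂ H] [CompleteSpace H]
    (d : ℕ) (hd : 2 ≤ d) (T : Fin d → H →L[ℂ] H) (hT : ∀ i, IsSelfAdjoint (T i)) :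
    caratheodoryNumber (jointNumericalRange T) ≤ ((d - 1 : ℕ) : ℕ∞) ∧
      (3 ≤ d → 3 ≤ Module.rank ℂ H →
        caratheodoryNumber (jointNumericalRange T) ≤ ((d - 2 : ℕ) : ℕ∞)) := by
  refine ⟨caratheodoryNumber_le (by omega) fun x hx => ?_,
    fun hd3 hH => caratheodoryNumber_le (by omega) fun x hx => ?_⟩
  · obtain ⟨r, hr⟩ := exists_isFormSum_of_mem_convexHull hx
    obtain ⟨m, hm, hxm⟩ := hr.exists_le (n := d - 1) fun k hk => by
      have : d ≤ k + 1 := by omega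
      nlinarith
    exact hxm.isConvexCombOfAtMost hT hm
  · obtain ⟨r, hr⟩ := exists_isFormSum_of_mem_convexHull hx
    rcases hd3.eq_or_lt with rfl | hd4
    · obtain ⟨m, hm, hxm⟩ := hr.exists_le (n := 2) fun k hk => by nlinarith
      rcases hm.eq_or_lt with rfl | hm
      · exact (hxm.one_of_two hH hT).isConvexCombOfAtMost hT le_rfl
      · exact hxm.isConvexCombOfAtMost hT (by omega)
    · obtain ⟨m, hm, hxm⟩ := hr.exists_le (n := d - 2) fun k hk => by
        obtain ⟨e, rfl⟩ : ∃ e, d = e + 4 := ⟨d - 4, by omega⟩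
        have : e + 3 ≤ k + 1 := by omega
        nlinarith
      exact hxm.isConvexCombOfAtMost hT hm
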